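/- Let $\mathcal G=(\mathcal V,\mathcal E,\boldsymbol W)$ be a strongly connected weighted digraph on $\mathcal V=\{1,\dots,n\}$ with nonnegative weighted adjacency matrix $\boldsymbol W$ (for $n=1$ the vertex carries a loop, so that the walk below is defined). Let $d_i=\sum_j \boldsymbol W_{i,j}$ be the (out-)degree of $i$, $d_{\mathcal G}=\sum_i d_i$ the volume, $\boldsymbol P_{i,j}=\boldsymbol W_{i,j}/d_i$ the transition matrix of the random walk on $\mathcal G$, $\boldsymbol\pi$ its stationary distribution ($\boldsymbol\pi^\top\boldsymbol P=\boldsymbol\pi^\top$, $\boldsymbol\pi^\top\mathbf 1=1$), and $\boldsymbol\Pi=\mathrm{Diag}(\boldsymbol\pi)$. Let $H(i,j)$ be the expected time at which the walk started at $i$ first visits $j$ (so $H(i,i)=0$), and let $P_{\mathrm{es}}(i,j)$ be the probability that the walk started at $i$ reaches $j$ before it returns to $i$. Put $\Omega(i,i)=0$ and $\Omega(i,j)=\dfrac{1}{d_{\mathcal G}\boldsymbol\pi_i P_{\mathrm{es}}(i,j)}$ for $i\ne j$, and define $$R(\mathcal G)=\sum_{i<j}\Omega(i,j),\qquad R^*(\mathcal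 G)=d_{\mathcal G}^2\sum_{i<j}\boldsymbol\pi_i\boldsymbol\pi_j\,\Omega(i,j),\qquad K(\mathcal G)=\sum_{j}\boldsymbol\pi_jH(i,j),$$ $$\boldsymbol L=d_{\mathcal G}\boldsymbol\Pi(\boldsymbol I-\boldsymbol P),\qquad \widetilde{\boldsymbol L}=\frac{\boldsymbol\Pi^{-1/2}}{\sqrt{d_{\mathcal G}}}\,\boldsymbol L\,\frac{\boldsymbol\Pi^{-1/2}}{\sqrt{d_{\mathcal G}}}.$$ Write $\boldsymbol A^\dagger$ for the Moore–Penrose inverse of a matrix and $\lambda_1(\boldsymbol A),\dots,\lambda_n(\boldsymbol A)$ for its complex eigenvalues with algebraic multiplicity. Then: 1. $R(\mathcal G)=n\,\mathrm{Tr}(\boldsymbol L^\dagger)=n\displaystyle\sum_{\lambda_i(\boldsymbol L)\neq0}\frac1{\lambda_i(\boldsymbol L)}$. 2. $K(\mathcal G)$ is finite and, for every choice of the starting vertex $i$ in its definition, $$R^*(\mathcal G)=d_{\mathcal G}K(\mathcal G)=d_{\mathcal G}\sum_{\lambda_i(\widetilde{\boldsymbol L})\neq0}\frac1{\lambda_i(\widetilde{\boldsymbol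 L})}=d_{\mathcal G}\,\mathrm{Tr}(\widetilde{\boldsymbol L}^\dagger).$$ -/

import Mathlib

open MeasureTheory ProbabilityTheory
open scoped ENNReal

/-- A strongly connected weighted digraph on the vertex set `{0, …, n - 1}`, given by its weighted
adjacency matrix: there is an arc from `i` to `j` exactly when `0 < weight i j`.
Reachability is by directed walks with at least one arc. For `2 ≤ n` this is the same as
reachability of every vertex from every other vertex; for `n = 1` it asks for a loop, without which
the single vertex has degree zero and no random walk exists. -/
structure StronglyConnectedDigraph (n : ℕ) where
  weight : Matrix (Fin n) (Fin n) ℝ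
  weight_nonneg : ∀ i j, 0 ≤ weight i j
  connected : ∀ i j, Relation.TransGen (fun a b => 0 < weight a b) i j

/-- `X` is the Moore–Penrose inverse of the real square matrix `A`. -/
structure IsMoorePenroseInverse {n : ℕ} (A X : Matrix (Fin n) (Fin n) ℝ) : Prop where
  mul_mul_self : A * X * A = A
  inv_mul_mul : X * A * X = X
  symm_left : (A * X).transpose = A * X
  symm_right : (X * A).transpose = X * A

/-- The Moore–Penrose inverse `A†`: the (unique) matrix with the four Penrose properties. -/
noncomputable def pseudoinverse {n : ℕ} (A : Matrix (Fin n) (Fin n) ℝ) :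
    Matrix (Fin n) (Fin n) ℝ :=
  Classical.epsilon (IsMoorePenroseInverse A)

/-- `∑_{λ_i(A) ≠ 0} 1 / λ_i(A)`, over the `n` complex eigenvalues of the real matrix `A`, counted
with algebraic multiplicity (that is, over the roots of the characteristic polynomial). -/
noncomputable def sumInvNonzeroEigenvalues {n : ℕ} (A : Matrix (Fin n) (Fin n) ℝ) : ℂ :=
  (((A.map Complex.ofReal).charpoly.roots.filter (fun z => z ≠ 0)).map (fun z => 1 / z)).sum

namespace StronglyConnectedDigraph

variable {n : ℕ} (G : StronglyConnectedDigraph n)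

/-- The (out-)degree of a vertex. -/
noncomputable def degree (i : Fin n) : ℝ := ∑ j, G.weight i j

/-- The volume `d_G`. -/
noncomputable def volume : ℝ := ∑ i, G.degree i

/-- The transition matrix `P = D⁻¹ W`. -/
noncomputable def transition : Matrix (Fin n) (Fin n) ℝ :=
  Matrix.of fun i j => G.weight i j / G.degree i

theorem degree_pos (i : Fin n) : 0 < G.degree i := by
  obtain ⟨k, hk, -⟩ := Relation.TransGen.head'_iff.mp (G.connected i i)
  exact lt_of_lt_of_le hk
    (Finset.single_le_sum (fun j _ => G.weight_nonneg i j) (Finset.mem_univ k))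

theorem sum_ofReal_transition (i : Fin n) :
    ∑ j, ENNReal.ofReal (G.transition i j) = 1 := by
  rw [← ENNReal.ofReal_sum_of_nonneg]
  · have h : ∑ j, G.transition i j = 1 := by
      simp only [transition, Matrix.of_apply, ← Finset.sum_div]
      exact div_self (G.degree_pos i).ne'
    rw [h, ENNReal.ofReal_one]
  · intro j _
    exact div_nonneg (G.weight_nonneg i j) (G.degree_pos i).le

/-- The law of the next vertex of a walker at `i`: vertex `j` has probability `P i j`. -/
noncomputable def stepLaw (i : Fin n) : PMF (Fin n) :=
  PMF.ofFintype (fun j => ENNReal.ofReal (G.transition i j)) (G.sum_ofReal_transition i)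

/-- The one-step kernel of the walk, as a kernel on histories up to time `t`: the next vertex
depends on the history through the vertex at time `t` only. -/
noncomputable def historyKernel (t : ℕ) : Kernel ((_ : Finset.Iic t) → Fin n) (Fin n) :=
  Kernel.ofFunOfCountable fun x => (G.stepLaw (x ⟨t, Finset.mem_Iic.mpr le_rfl⟩)).toMeasure

instance isMarkovKernel_historyKernel (t : ℕ) : IsMarkovKernel (G.historyKernel t) where
  isProbabilityMeasure x :=
    PMF.toMeasure.isProbabilityMeasure (G.stepLaw (x ⟨t, Finset.mem_Iic.mpr le_rfl⟩))

/-- The law, on the space `ℕ → Fin n` of trajectories, of the random walk started at `i`. -/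
noncomputable def walkLaw (i : Fin n) : Measure (ℕ → Fin n) :=
  Kernel.traj (X := fun _ => Fin n) G.historyKernel 0 (fun _ => i)

/-- `p` is a stationary distribution: `pᵀ P = pᵀ` and the entries of `p` sum to one. -/
def IsStationary (p : Fin n → ℝ) : Prop :=
  Matrix.vecMul p G.transition = p ∧ ∑ i, p i = 1

/-- The (unique) stationary distribution `π`. -/
noncomputable def stationary : Fin n → ℝ := Classical.epsilon G.IsStationary

/-- The first time (possibly `∞`, possibly `0`) at which the trajectory `ω` is at `j`. -/
noncomputable def firstVisit (j : Fin n) (ω : ℕ → Fin n) : ℝ≥0∞ :=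
  ⨅ (t : ℕ) (_ : ω t = j), (t : ℝ≥0∞)

/-- The hitting time `H(i, j)`: the expected first time at which the walk from `i` visits `j`. -/
noncomputable def hittingTime (i j : Fin n) : ℝ≥0∞ :=
  ∫⁻ ω, firstVisit j ω ∂(G.walkLaw i)

/-- Kemeny's constant `∑_j π_j H(i, j)`, computed from the starting vertex `i`. -/
noncomputable def kemeny (i : Fin n) : ℝ≥0∞ :=
  ∑ j, ENNReal.ofReal (G.stationary j) * G.hittingTime i j

/-- The escape probability: the probability that the walk from `i` reaches `j` before it
returns to `i`. -/
noncomputable def escapeProb (i j : Fin n) : ℝ :=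
  (G.walkLaw i).real {ω | ∃ t, 1 ≤ t ∧ ω t = j ∧ ∀ s, 1 ≤ s → s < t → ω s ≠ i}

/-- The resistance distance `Ω(i, j)`. -/
noncomputable def resistance (i j : Fin n) : ℝ :=
  if i = j then 0 else 1 / (G.volume * G.stationary i * G.escapeProb i j)

/-- The Kirchhoff index `R(G)`. -/
noncomputable def kirchhoff : ℝ := ∑ i, ∑ j ∈ Finset.Ioi i, G.resistance i j

/-- The multiplicative Kirchhoff index `R*(G)`. -/
noncomputable def mulKirchhoff : ℝ :=
  G.volume ^ 2 *
    ∑ i, ∑ j ∈ Finset.Ioi i, G.stationary i * G.stationary j * G.resistance i j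

/-- The Laplacian `L = d_G Π (I - P)`. -/
noncomputable def laplacian : Matrix (Fin n) (Fin n) ℝ :=
  G.volume • (Matrix.diagonal G.stationary * (1 - G.transition))

/-- The normalized Laplacian `(Π^{-1/2} / √d_G) L (Π^{-1/2} / √d_G)`. -/
noncomputable def normalizedLaplacian : Matrix (Fin n) (Fin n) ℝ :=
  Matrix.diagonal (fun i => (√(G.stationary i))⁻¹ / √G.volume) * G.laplacian *
    Matrix.diagonal (fun i => (√(G.stationary i))⁻¹ / √G.volume)

end StronglyConnectedDigraph

/-! Both indices are traces of one matrix. Weighting `I - P` by the stationary distribution makes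
the column sums of `L` vanish as well as its row sums, so the unit constant vector `v` spans the
left and the right kernel, although `L` need not be symmetric. Then `L + vvᵀ` is invertible, and `M
= (L + vvᵀ)⁻¹ - vvᵀ` satisfies `LM = ML = 1 - vvᵀ`. Symmetry of this projection makes `M` the
Moore–Penrose inverse. Adding `vvᵀ` turns one eigenvalue `0` into `1` and keeps the others, so `Tr
M` is the sum of the inverse nonzero eigenvalues; no diagonalizability is needed.

First-step analysis turns probability into Poisson equations. The probability `h` of reaching `j`
before `i` satisfies `Lh = c(e_j - e_i)` with `c = d π_i P_es(i,j)`; as `h j - h i = 1`, this gives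
`Ω(i,j) = M_ii + M_jj - M_ij - M_ji`. The hitting times of `j` satisfy `LH = d(π - e_j)`, which
expresses `H(i,j)` through `M`. Summing `Ω` with weights `1` gives `n Tr M`; weights `π` give `d²(∑
π_i M_ii - πᵀMπ)`, and in Kemeny's sum the terms depending on the start cancel to leave `d(∑ π_i
M_ii - πᵀMπ)`. The same number is the trace of the pseudoinverse of the normalized Laplacian, whose
kernel vector on both sides is `√π`. -/

/-! ### Characteristic polynomials: rank-one shifts and inverses -/

open Polynomial in
-- Since `A v = 0`, the product `(X - A)(X - vwᵀ)` has no `A vwᵀ` term and equals `X (X - A - vwᵀ)`;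
-- take determinants. In effect one eigenvalue `0` moves to `1`, with all multiplicities kept.
theorem Matrix.X_mul_charpoly_add_vecMulVec {n : ℕ} {R : Type*} [CommRing R] [IsDomain R]
    (A : Matrix (Fin n) (Fin n) R) (v w : Fin n → R) (h : w ⬝ᵥ v = 1)
    (hAv : A.mulVec v = 0) :
    X * (A + Matrix.vecMulVec v w).charpoly = (X - 1) * A.charpoly := by
  have hn : 0 < n := by
    rcases Nat.eq_zero_or_pos n with rfl | hn
    · simp [dotProduct] at h
    · exact hn
  have hAE : A * Matrix.vecMulVec v w = 0 := by
    rw [Matrix.mul_vecMulVec, hAv]; simp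
  have key : A.charmatrix * (Matrix.vecMulVec v w).charmatrix =
      (X : R[X]) • (A + Matrix.vecMulVec v w).charmatrix := by
    have h0 : A.map C * (Matrix.vecMulVec v w).map C = 0 := by
      rw [← Matrix.map_mul, hAE]; simp
    have hmap : (A + Matrix.vecMulVec v w).map C = A.map C + (Matrix.vecMulVec v w).map C := by
      ext; simp
    simp only [Matrix.charmatrix, RingHom.mapMatrix_apply, hmap]
    rw [sub_mul, mul_sub, mul_sub, h0]
    simp only [Matrix.scalar_apply, ← Matrix.smul_one_eq_diagonal]
    simp only [smul_mul_assoc, one_mul, mul_smul_comm, mul_one, smul_sub, smul_add]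
    abel
  have hdet := congrArg Matrix.det key
  rw [Matrix.det_mul, Matrix.det_smul] at hdet
  change A.charpoly * (Matrix.vecMulVec v w).charpoly = _ * (A + _).charpoly at hdet
  rw [Matrix.charpoly_vecMulVec, dotProduct_comm, h, Fintype.card_fin] at hdet
  -- The determinants carry the factor `X ^ n` on one side and `X ^ n - X ^ (n - 1)` on the other;
  -- `m = n - 1` is the power to cancel.
  obtain ⟨m, rfl⟩ := Nat.exists_eq_succ_of_ne_zero hn.ne'
  apply mul_left_cancel₀ (pow_ne_zero m (X_ne_zero (R := R)))
  simp only [Nat.succ_eq_add_one, Nat.add_sub_cancel, one_smul] at hdet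
  linear_combination -hdet

open Polynomial in
-- Reversal is multiplicative over a domain and sends `X - a` to `1 - aX`.
theorem Polynomial.roots_reverse_prod_X_sub_C {K : Type*} [Field K] (s : Multiset K)
    (hs : ∀ z ∈ s, z ≠ 0) :
    ((s.map (fun z => X - C z)).prod).reverse.roots = s.map (fun z => z⁻¹) := by
  induction s using Multiset.induction_on with
  | empty => simp [show (1 : K[X]) = C 1 from rfl, -map_one]
  | cons a s ih =>
    have ha : a ≠ 0 := hs a (by simp)
    have hrev : (X - C a : K[X]).reverse = C (-a) * X + C 1 := by
      have hX : (X : K[X]).reverse = 1 :=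
        Eq.trans (by simpa using reverse_mul_X (1 : K[X])) (by rw [← C_1, reverse_C])
      have := reverse_C_add (X : K[X]) (-a)
      rw [natDegree_X, pow_one, hX] at this
      rw [show (X - C a : K[X]) = C (-a) + X by rw [C_neg]; ring, this, C_1]
    rw [Multiset.map_cons, Multiset.prod_cons, reverse_mul_of_domain, roots_mul, ih, hrev,
      show C (-a) * X + C 1 = C (((Units.mk0 a ha)⁻¹⁻¹ * -1 : Kˣ) : K) * X + C 1 by simp,
      roots_C_mul_X_add_C_of_IsUnit, Multiset.map_cons]
    · simp
    · exact fun z hz => hs z (by simp [hz])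
    · rw [← reverse_mul_of_domain, Ne, reverse_eq_zero]
      refine mul_ne_zero (X_sub_C_ne_zero a) ?_
      exact (monic_multiset_prod_of_monic _ _ fun z _ => monic_X_sub_C z).ne_zero

open Polynomial in
/-- The trace of the inverse is the sum of the inverses of the eigenvalues. -/
theorem Matrix.sum_inv_roots_charpoly {n : ℕ} {K : Type*} [Field K] [IsAlgClosed K]
    (A B : Matrix (Fin n) (Fin n) K) (h : A * B = 1) :
    (A.charpoly.roots.map (fun z => z⁻¹)).sum = B.trace := by
  have hA : IsUnit A := IsUnit.of_mul_eq_one B h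
  have hB : B = A⁻¹ := (Matrix.inv_eq_right_inv h).symm
  have hdet : A.det ≠ 0 := ((Matrix.isUnit_iff_isUnit_det _).1 hA).ne_zero
  rw [Matrix.trace_eq_sum_roots_charpoly, hB, Matrix.charpoly_inv _ hA,
    ← Matrix.reverse_charpoly]
  congr 1
  -- The characteristic polynomial of `A⁻¹` is the reverse of that of `A` up to this nonzero
  -- constant.
  have hc : ((-1) ^ Fintype.card (Fin n) * C (Ring.inverse A.det) : K[X]) =
      C ((-1) ^ n * A.det⁻¹) := by
    simp [Ring.inverse_eq_inv']
  rw [hc, roots_C_mul _ (by simp [hdet])]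
  have h0 : A.charpoly.coeff 0 ≠ 0 := by
    rw [Matrix.det_eq_sign_charpoly_coeff] at hdet
    exact right_ne_zero_of_mul hdet
  have hf : A.charpoly = (A.charpoly.roots.map (fun z => X - C z)).prod := by
    simpa [A.charpoly_monic.leadingCoeff] using (IsAlgClosed.splits A.charpoly).eq_prod_roots
  conv_rhs => rw [hf]
  rw [roots_reverse_prod_X_sub_C]
  intro z hz hz0
  have hz' := (mem_roots'.1 hz).2
  rw [hz0, IsRoot, ← coeff_zero_eq_eval_zero] at hz'
  exact h0 hz'

/-! ### Moore–Penrose inverses and matrices with a common left and right kernel vector -/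

theorem IsMoorePenroseInverse.unique {n : ℕ} {A X Y : Matrix (Fin n) (Fin n) ℝ}
    (hX : IsMoorePenroseInverse A X) (hY : IsMoorePenroseInverse A Y) : X = Y := by
  have h1 : A * X = A * Y := by
    calc A * X = (A * Y * A * X) := by rw [hY.mul_mul_self]
      _ = (A * Y) * (A * X) := by simp only [mul_assoc]
      _ = ((A * X) * (A * Y)).transpose := by
          rw [Matrix.transpose_mul, hX.symm_left, hY.symm_left]
      _ = (A * X * A * Y).transpose := by simp only [mul_assoc]
      _ = A * Y := by rw [hX.mul_mul_self, hY.symm_left]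
  have h2 : X * A = Y * A := by
    calc X * A = X * (A * Y * A) := by rw [hY.mul_mul_self]
      _ = (X * A) * (Y * A) := by simp only [mul_assoc]
      _ = ((Y * A) * (X * A)).transpose := by
          rw [Matrix.transpose_mul, hX.symm_right, hY.symm_right]
      _ = (Y * (A * X * A)).transpose := by simp only [mul_assoc]
      _ = Y * A := by rw [hX.mul_mul_self, hY.symm_right]
  calc X = X * A * X := hX.inv_mul_mul.symm
    _ = Y * (A * X) := by rw [h2, mul_assoc]
    _ = Y := by rw [h1, ← mul_assoc, hY.inv_mul_mul]

theorem IsMoorePenroseInverse.pseudoinverse_eq {n : ℕ} {A X : Matrix (Fin n) (Fin n) ℝ}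
    (hX : IsMoorePenroseInverse A X) : pseudoinverse A = X :=
  IsMoorePenroseInverse.unique (Classical.epsilon_spec ⟨X, hX⟩) hX

/-- `X` inverts `A` on the orthogonal complement of the unit vector `v`, which spans both the left
and the right kernel of `A`. -/
structure InvertsOffVector {n : ℕ} (A X : Matrix (Fin n) (Fin n) ℝ) (v : Fin n → ℝ) : Prop where
  unit : v ⬝ᵥ v = 1
  mulVec_eq : A.mulVec v = 0
  vecMul_eq : Matrix.vecMul v A = 0
  inv_mulVec_eq : X.mulVec v = 0
  inv_vecMul_eq : Matrix.vecMul v X = 0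
  mul_eq : A * X = 1 - Matrix.vecMulVec v v
  inv_mul_eq : X * A = 1 - Matrix.vecMulVec v v

namespace InvertsOffVector

variable {n : ℕ} {A X : Matrix (Fin n) (Fin n) ℝ} {v : Fin n → ℝ}

theorem pseudoinverse_eq (h : InvertsOffVector A X v) : pseudoinverse A = X := by
  apply IsMoorePenroseInverse.pseudoinverse_eq
  have ht : (1 - Matrix.vecMulVec v v).transpose = 1 - Matrix.vecMulVec v v := by
    simp [Matrix.transpose_vecMulVec]
  refine ⟨?_, ?_, ?_, ?_⟩
  · rw [h.mul_eq, sub_mul, Matrix.vecMulVec_mul, h.vecMul_eq]; simp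
  · rw [h.inv_mul_eq, sub_mul, Matrix.vecMulVec_mul, h.inv_vecMul_eq]; simp
  · rw [h.mul_eq, ht]
  · rw [h.inv_mul_eq, ht]

theorem add_mul_add (h : InvertsOffVector A X v) :
    (A + Matrix.vecMulVec v v) * (X + Matrix.vecMulVec v v) = 1 := by
  rw [add_mul, mul_add, mul_add, h.mul_eq, Matrix.mul_vecMulVec, Matrix.vecMulVec_mul,
    h.mulVec_eq, h.inv_vecMul_eq, Matrix.vecMulVec_mul_vecMulVec, h.unit]
  simp

open Polynomial in
-- `A + vvᵀ` has inverse `X + vvᵀ`, of trace `Tr X + 1`, and its eigenvalues are those of `A` with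
-- one `0` replaced by `1`; that new eigenvalue accounts for the extra `1`.
theorem sumInvNonzeroEigenvalues_eq (h : InvertsOffVector A X v) :
    sumInvNonzeroEigenvalues A = (X.trace : ℂ) := by
  set f : ℝ →+* ℂ := Complex.ofRealHom
  have hmap : ∀ M : Matrix (Fin n) (Fin n) ℝ, M.map Complex.ofReal = f.mapMatrix M := fun _ => rfl
  set B := A + Matrix.vecMulVec v v
  have hB : f.mapMatrix B * f.mapMatrix (X + Matrix.vecMulVec v v) = 1 := by
    rw [← map_mul, h.add_mul_add, map_one]
  have hsum := Matrix.sum_inv_roots_charpoly _ _ hB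
  have hp : Polynomial.X * (f.mapMatrix B).charpoly =
      (Polynomial.X - 1) * (f.mapMatrix A).charpoly := by
    have := congrArg (Polynomial.map f)
      (Matrix.X_mul_charpoly_add_vecMulVec A v v h.unit h.mulVec_eq)
    rw [Polynomial.map_mul, Polynomial.map_mul, ← Matrix.charpoly_map, ← Matrix.charpoly_map] at this
    simpa using this
  have hr := congrArg Polynomial.roots hp
  have hX1 : (Polynomial.X - 1 : ℂ[X]) ≠ 0 := by simpa using X_sub_C_ne_zero (1 : ℂ)
  rw [roots_mul (mul_ne_zero X_ne_zero (Matrix.charpoly_monic _).ne_zero),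
    roots_mul (mul_ne_zero hX1 (Matrix.charpoly_monic _).ne_zero), roots_X,
    show (Polynomial.X - 1 : ℂ[X]) = Polynomial.X - C 1 by simp, roots_X_sub_C] at hr
  have h0 : ∀ z ∈ (f.mapMatrix B).charpoly.roots, z ≠ 0 := by
    rintro z hz rfl
    have hdet : (f.mapMatrix B).det ≠ 0 := by
      intro h0
      have := congrArg Matrix.det hB
      rw [Matrix.det_mul, h0] at this
      simp at this
    rw [Matrix.det_eq_sign_charpoly_coeff] at hdet
    have hz' := (mem_roots'.1 hz).2
    rw [IsRoot, ← coeff_zero_eq_eval_zero] at hz'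
    exact hdet (by rw [hz', mul_zero])
  -- Dropping zeros from `{0} + roots B = {1} + roots A` leaves all the roots of `B` on one side,
  -- and `1` with the nonzero roots of `A` on the other.
  have hr' := congrArg (Multiset.filter (fun z : ℂ => z ≠ 0)) hr
  rw [Multiset.filter_add, Multiset.filter_add, Multiset.filter_eq_self.2 h0] at hr'
  have hr2 := congrArg (fun s : Multiset ℂ => (s.map (fun z => z⁻¹)).sum) hr'
  simp only [Multiset.map_add, Multiset.sum_add, Multiset.filter_singleton] at hr2
  rw [hsum] at hr2
  have htr : (f.mapMatrix (X + Matrix.vecMulVec v v)).trace = (X.trace : ℂ) + 1 := by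
    rw [show (f.mapMatrix (X + Matrix.vecMulVec v v)).trace =
      f (X + Matrix.vecMulVec v v).trace from
        (AddMonoidHom.map_trace f.toAddMonoidHom _).symm, Matrix.trace_add,
      Matrix.trace_vecMulVec, h.unit]
    simp [f]
  rw [htr] at hr2
  simp only [sumInvNonzeroEigenvalues, one_div, hmap]
  simp [-RingHom.mapMatrix_apply] at hr2
  simp only [ne_eq]
  linear_combination -hr2

end InvertsOffVector
-- The law of the walk: cylinders and the first-step decomposition
namespace StronglyConnectedDigraph

variable {n : ℕ} (G : StronglyConnectedDigraph n)

instance isProbabilityMeasure_walkLaw (i : Fin n) : IsProbabilityMeasure (G.walkLaw i) := by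
  unfold walkLaw; infer_instance

/-- The trajectory that starts at `i` and then follows `ω`. -/
def consPath (i : Fin n) (ω : ℕ → Fin n) : ℕ → Fin n
  | 0 => i
  | t + 1 => ω t

/-- The trajectories that agree with `x` up to time `t`. -/
def cylinder (x : ℕ → Fin n) (t : ℕ) : Set (ℕ → Fin n) := {ω | ∀ s ≤ t, ω s = x s}

theorem cylinder_eq_preimage (x : ℕ → Fin n) (t : ℕ) :
    cylinder x t = Preorder.frestrictLe (π := fun _ => Fin n) t ⁻¹' {Preorder.frestrictLe t x} := by
  ext ω
  simp only [cylinder, Set.mem_ofPred_eq, Set.mem_preimage, Set.mem_singleton_iff, funext_iff,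
    Subtype.forall, Finset.mem_Iic, Preorder.frestrictLe_apply]

theorem measurable_consPath (i : Fin n) : Measurable (consPath i) := by
  refine measurable_pi_iff.2 fun t => ?_
  cases t with
  | zero => exact measurable_const
  | succ t => exact measurable_pi_apply t

theorem measurableSet_cylinder (x : ℕ → Fin n) (t : ℕ) : MeasurableSet (cylinder x t) := by
  rw [cylinder_eq_preimage]
  exact Preorder.measurable_frestrictLe t (measurableSet_singleton _)

theorem walkLaw_cylinder_zero (i : Fin n) (x : ℕ → Fin n) :
    G.walkLaw i (cylinder x 0) = if x 0 = i then 1 else 0 := by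
  rw [cylinder_eq_preimage, ← Measure.map_apply (Preorder.measurable_frestrictLe 0)
    (measurableSet_singleton _), walkLaw, Kernel.traj_map_frestrictLe_apply,
    Kernel.partialTraj_self, Kernel.id_apply, Measure.dirac_apply' _ (measurableSet_singleton _)]
  simp only [Set.indicator_apply, Set.mem_singleton_iff, funext_iff, Subtype.forall,
    Finset.mem_Iic, Preorder.frestrictLe_apply, Pi.one_apply]
  congr 1
  simp [eq_comm]

theorem walkLaw_cylinder_succ (i : Fin n) (x : ℕ → Fin n) (t : ℕ) :
    G.walkLaw i (cylinder x (t + 1)) =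
      G.walkLaw i (cylinder x t) * ENNReal.ofReal (G.transition (x t) (x (t + 1))) := by
  have h := Kernel.partialTraj_compProd_eq_map_traj (X := fun _ => Fin n) (κ := G.historyKernel)
    (Nat.zero_le t) (x₀ := fun _ => i)
  have h2 := congrArg (fun μ => μ ({Preorder.frestrictLe t x} ×ˢ {x (t + 1)})) h
  beta_reduce at h2
  rw [Measure.map_apply (by fun_prop)
    ((measurableSet_singleton _).prod (measurableSet_singleton _)),
    Measure.compProd_apply_prod (measurableSet_singleton _) (measurableSet_singleton _),
    ← Kernel.traj_map_frestrictLe_apply, lintegral_singleton,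
    Measure.map_apply (Preorder.measurable_frestrictLe t) (measurableSet_singleton _),
    ← cylinder_eq_preimage] at h2
  have hset : (fun ω : ℕ → Fin n => (Preorder.frestrictLe (π := fun _ => Fin n) t ω, ω (t + 1))) ⁻¹'
      ({Preorder.frestrictLe t x} ×ˢ {x (t + 1)}) = cylinder x (t + 1) := by
    rw [Set.mk_preimage_prod, ← cylinder_eq_preimage]
    ext ω
    simp only [cylinder, Set.mem_inter_iff, Set.mem_ofPred_eq, Set.mem_preimage,
      Set.mem_singleton_iff]
    constructor
    · rintro ⟨h1, h2⟩ s hs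
      rcases Nat.le_succ_iff.1 hs with hs | rfl
      exacts [h1 s hs, h2]
    · exact fun h => ⟨fun s hs => h s (hs.trans t.le_succ), h _ le_rfl⟩
  rw [hset] at h2
  have hk : G.historyKernel t (Preorder.frestrictLe t x) {x (t + 1)} =
      ENNReal.ofReal (G.transition (x t) (x (t + 1))) := by
    simp only [historyKernel, Kernel.ofFunOfCountable]
    change (G.stepLaw (x t)).toMeasure {x (t + 1)} = _
    rw [PMF.toMeasure_apply_singleton _ _ (measurableSet_singleton _)]
    simp [stepLaw]
  rw [hk] at h2
  rw [walkLaw, ← h2, mul_comm]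

theorem consPath_preimage_cylinder_succ (k : Fin n) (x : ℕ → Fin n) (t : ℕ) :
    consPath k ⁻¹' cylinder x (t + 1) =
      if x 0 = k then cylinder (fun s => x (s + 1)) t else ∅ := by
  ext ω
  split_ifs with h
  · simp only [cylinder, Set.mem_preimage, Set.mem_ofPred_eq]
    constructor
    · exact fun h s hs => h (s + 1) (by omega)
    · intro h' s hs
      cases s with
      | zero => exact h.symm
      | succ s => exact h' s (by omega)
  · simp only [cylinder, Set.mem_preimage, Set.mem_ofPred_eq, Set.mem_empty_iff_false, iff_false]
    exact fun h' => h (h' 0 (by omega)).symm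

/-- The trajectory measure is built by appending last steps; the Markov property needs the first
step split off. Induction on the length converts one product into the other. -/
theorem walkLaw_cylinder_succ_left (i : Fin n) (x : ℕ → Fin n) (t : ℕ) :
    G.walkLaw i (cylinder x (t + 1)) = if x 0 = i then
      ENNReal.ofReal (G.transition i (x 1)) *
        G.walkLaw (x 1) (cylinder (fun s => x (s + 1)) t) else 0 := by
  induction t with
  | zero =>
    rw [walkLaw_cylinder_succ, walkLaw_cylinder_zero, walkLaw_cylinder_zero]
    split_ifs with h <;> simp_all
  | succ t ih =>
    rw [walkLaw_cylinder_succ, ih, walkLaw_cylinder_succ]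
    split_ifs with h
    · rw [mul_assoc]
    · simp

theorem walkLaw_cylinder_of_ne (i : Fin n) (x : ℕ → Fin n) (t : ℕ) (h : x 0 ≠ i) :
    G.walkLaw i (cylinder x t) = 0 := by
  cases t with
  | zero => rw [walkLaw_cylinder_zero, if_neg h]
  | succ t => rw [walkLaw_cylinder_succ_left, if_neg h]

/-- Finite histories form a discrete space, so cylinder masses fix all finite-dimensional marginals.
Only positive times are required, because a cylinder of length zero has no first step to split off.
-/
theorem measure_ext_of_cylinder {μ ν : Measure (ℕ → Fin n)} [IsFiniteMeasure μ]
    [IsFiniteMeasure ν] (h : ∀ x t, μ (cylinder x (t + 1)) = ν (cylinder x (t + 1))) : μ = ν := by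
  have hν : IsProjectiveMeasureFamily (α := fun _ : ℕ => Fin n)
      fun I : Finset ℕ => ν.map I.restrict := by
    intro I J hJI
    rw [Measure.map_map (by fun_prop) (by fun_prop), Finset.restrict₂_comp_restrict]
  refine IsProjectiveLimit.unique (P := fun I : Finset ℕ => ν.map I.restrict) ?_ fun I => rfl
  refine (isProjectiveLimit_nat_iff' hν μ 1).2 fun b hb => ?_
  obtain ⟨t, rfl⟩ := Nat.exists_eq_add_of_le' hb
  refine Measure.ext_of_singleton fun a => ?_
  -- Extend the finite history to a trajectory by freezing it after its last time.
  have ha : ∃ x : ℕ → Fin n, Preorder.frestrictLe (t + 1) x = a :=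
    ⟨fun s => a ⟨min s (t + 1), by simp⟩, by
      ext s
      have hs := Finset.mem_Iic.1 s.2
      simp [Preorder.frestrictLe_apply, min_eq_left hs]⟩
  obtain ⟨x, rfl⟩ := ha
  rw [Measure.map_apply (Preorder.measurable_frestrictLe _) (measurableSet_singleton _),
    Measure.map_apply (by fun_prop) (measurableSet_singleton _)]
  have := h x t
  rwa [cylinder_eq_preimage] at this

/-- The Markov property at time one. -/
theorem walkLaw_eq_sum (i : Fin n) :
    G.walkLaw i =
      ∑ k, ENNReal.ofReal (G.transition i k) • (G.walkLaw k).map (consPath i) := by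
  have : IsFiniteMeasure
      (∑ k, ENNReal.ofReal (G.transition i k) • (G.walkLaw k).map (consPath i)) := by
    refine ⟨?_⟩
    simp only [Measure.finsetSum_apply, Measure.smul_apply, smul_eq_mul]
    exact ENNReal.sum_lt_top.2 fun k _ => ENNReal.mul_lt_top ENNReal.ofReal_lt_top
      (measure_lt_top _ _)
  refine measure_ext_of_cylinder fun x t => ?_
  simp only [Measure.finsetSum_apply, Measure.smul_apply, smul_eq_mul,
    Measure.map_apply (measurable_consPath i) (measurableSet_cylinder _ _),
    consPath_preimage_cylinder_succ, walkLaw_cylinder_succ_left]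
  split_ifs with h
  · rw [Finset.sum_eq_single (x 1)]
    · intro k _ hk
      rw [walkLaw_cylinder_of_ne _ _ _ _ hk.symm, mul_zero]
    · simp
  · simp

theorem lintegral_walkLaw (i : Fin n) {f : (ℕ → Fin n) → ℝ≥0∞} (hf : Measurable f) :
    ∫⁻ ω, f ω ∂(G.walkLaw i) =
      ∑ k, ENNReal.ofReal (G.transition i k) * ∫⁻ ω, f (consPath i ω) ∂(G.walkLaw k) := by
  rw [walkLaw_eq_sum, lintegral_finsetSum_measure]
  simp only [lintegral_smul_measure, lintegral_map hf (measurable_consPath i), smul_eq_mul]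

theorem transition_nonneg (i j : Fin n) : 0 ≤ G.transition i j :=
  div_nonneg (G.weight_nonneg i j) (G.degree_pos i).le

theorem walkLaw_real_apply (i : Fin n) {s : Set (ℕ → Fin n)} (hs : MeasurableSet s) :
    (G.walkLaw i).real s =
      ∑ k, G.transition i k * (G.walkLaw k).real (consPath i ⁻¹' s) := by
  rw [Measure.real, walkLaw_eq_sum]
  simp only [Measure.finsetSum_apply, Measure.smul_apply, smul_eq_mul,
    Measure.map_apply (measurable_consPath i) hs]
  rw [ENNReal.toReal_sum
    (fun k _ => ENNReal.mul_ne_top ENNReal.ofReal_ne_top (measure_ne_top _ _))]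
  simp only [ENNReal.toReal_mul, ENNReal.toReal_ofReal (G.transition_nonneg _ _), Measure.real]

theorem sum_transition (i : Fin n) : ∑ j, G.transition i j = 1 := by
  simp only [transition, Matrix.of_apply, ← Finset.sum_div]
  exact div_self (G.degree_pos i).ne'

/-! ### Escape probabilities -/

/-- The event that the trajectory reaches `j` before it visits `i`. -/
def reachesBefore (i j : Fin n) : Set (ℕ → Fin n) := {ω | ∃ t, ω t = j ∧ ∀ s < t, ω s ≠ i}

theorem measurableSet_reachesBefore (i j : Fin n) : MeasurableSet (reachesBefore i j) := by
  have : reachesBefore i j =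
      ⋃ t : ℕ, ({ω | ω t = j} ∩ ⋂ s ∈ Set.Iio t, {ω : ℕ → Fin n | ω s ≠ i}) := by
    ext ω; simp [reachesBefore]
  rw [this]
  refine MeasurableSet.iUnion fun t => MeasurableSet.inter ?_
    (MeasurableSet.biInter (Set.to_countable _) fun s _ => ?_)
  · exact (measurable_pi_apply t : Measurable fun ω : ℕ → Fin n => ω t) (measurableSet_singleton j)
  · exact ((measurable_pi_apply s : Measurable fun ω : ℕ → Fin n => ω s)
      (measurableSet_singleton i)).compl

theorem consPath_preimage_reachesBefore (i j k : Fin n) :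
    consPath k ⁻¹' reachesBefore i j =
      if k = j then Set.univ else if k = i then ∅ else reachesBefore i j := by
  ext ω
  split_ifs with h1 h2
  · simp only [Set.mem_preimage, Set.mem_univ, iff_true]
    exact ⟨0, h1, by simp⟩
  · simp only [Set.mem_preimage, Set.mem_empty_iff_false, iff_false]
    rintro ⟨t, ht, hs⟩
    cases t with
    | zero => exact h1 ht
    | succ t => exact hs 0 (by omega) h2
  · constructor
    · rintro ⟨t, ht, hs⟩
      cases t with
      | zero => exact absurd ht h1
      | succ t => exact ⟨t, ht, fun s hst => hs (s + 1) (by omega)⟩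
    · rintro ⟨t, ht, hs⟩
      refine ⟨t + 1, ht, fun s hst => ?_⟩
      cases s with
      | zero => exact h2
      | succ s => exact hs s (by omega)

/-- The probability that the walk from `k` reaches `j` before it visits `i`. -/
noncomputable def reachProb (i j k : Fin n) : ℝ := (G.walkLaw k).real (reachesBefore i j)

theorem reachProb_target (i j : Fin n) : G.reachProb i j j = 1 := by
  rw [reachProb, walkLaw_real_apply _ _ (measurableSet_reachesBefore i j)]
  simp [consPath_preimage_reachesBefore, sum_transition]

theorem reachProb_source {i j : Fin n} (h : i ≠ j) : G.reachProb i j i = 0 := by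
  rw [reachProb, walkLaw_real_apply _ _ (measurableSet_reachesBefore i j)]
  simp [consPath_preimage_reachesBefore, h]

theorem reachProb_of_ne {i j k : Fin n} (hi : k ≠ i) (hj : k ≠ j) :
    G.reachProb i j k = ∑ l, G.transition k l * G.reachProb i j l := by
  rw [reachProb, walkLaw_real_apply _ _ (measurableSet_reachesBefore i j)]
  simp [consPath_preimage_reachesBefore, hi, hj, reachProb]

/-- After one step, "before returning to `i`" becomes "before visiting `i`" for the shifted
trajectory. -/
theorem escapeProb_eq_sum (i j : Fin n) :
    G.escapeProb i j = ∑ k, G.transition i k * G.reachProb i j k := by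
  have hset : consPath i ⁻¹'
      {ω | ∃ t, 1 ≤ t ∧ ω t = j ∧ ∀ s, 1 ≤ s → s < t → ω s ≠ i} = reachesBefore i j := by
    ext ω
    constructor
    · rintro ⟨t, ht1, ht, hs⟩
      obtain ⟨t, rfl⟩ := Nat.exists_eq_add_of_le' ht1
      exact ⟨t, ht, fun s hst => hs (s + 1) (by omega) (by omega)⟩
    · rintro ⟨t, ht, hs⟩
      refine ⟨t + 1, by omega, ht, fun s hs1 hst => ?_⟩
      obtain ⟨s, rfl⟩ := Nat.exists_eq_add_of_le' hs1
      exact hs s (by omega)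
  rw [escapeProb, walkLaw_real_apply, hset]
  · rfl
  · have : {ω : ℕ → Fin n | ∃ t, 1 ≤ t ∧ ω t = j ∧ ∀ s, 1 ≤ s → s < t → ω s ≠ i} =
        ⋃ t ∈ Set.Ici 1, ({ω | ω t = j} ∩ ⋂ s ∈ Set.Ico 1 t, {ω : ℕ → Fin n | ω s ≠ i}) := by
      ext ω; simp [and_left_comm]
    rw [this]
    refine MeasurableSet.biUnion (Set.to_countable _) fun t _ => MeasurableSet.inter ?_
      (MeasurableSet.biInter (Set.to_countable _) fun s _ => ?_)
    · exact (measurable_pi_apply t : Measurable fun ω : ℕ → Fin n => ω t) (measurableSet_singleton j)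
    · exact ((measurable_pi_apply s : Measurable fun ω : ℕ → Fin n => ω s)
      (measurableSet_singleton i)).compl

/-! ### Hitting times -/

theorem measurable_firstVisit (j : Fin n) : Measurable (firstVisit j) := by
  refine Measurable.iInf fun t => ?_
  exact (Measurable.of_discrete (f := fun x : Fin n => ⨅ _ : x = j, (t : ℝ≥0∞))).comp
    (measurable_pi_apply t)

theorem firstVisit_consPath_self (j : Fin n) (ω : ℕ → Fin n) :
    firstVisit j (consPath j ω) = 0 :=
  le_antisymm (iInf₂_le_of_le 0 rfl (by simp)) zero_le

theorem firstVisit_consPath_of_ne {i j : Fin n} (h : i ≠ j) (ω : ℕ → Fin n) :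
    firstVisit j (consPath i ω) = 1 + firstVisit j ω := by
  simp only [firstVisit]
  rw [← inf_iInf_nat_succ, ENNReal.add_iInf]
  have h0 : consPath i ω 0 ≠ j := h
  -- The term at time `0` is an infimum over an empty family, hence `⊤`, and drops out.
  rw [iInf_neg h0, top_inf_eq]
  refine iInf_congr fun t => ?_
  change ⨅ (_ : ω t = j), ((t + 1 : ℕ) : ℝ≥0∞) = _
  by_cases ht : ω t = j
  · simp [ht, add_comm]
  · simp [ht]

theorem hittingTime_self (j : Fin n) : G.hittingTime j j = 0 := by
  rw [hittingTime, lintegral_walkLaw _ _ (measurable_firstVisit j)]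
  simp [firstVisit_consPath_self]

theorem hittingTime_of_ne {i j : Fin n} (h : i ≠ j) :
    G.hittingTime i j = 1 + ∑ k, ENNReal.ofReal (G.transition i k) * G.hittingTime k j := by
  rw [hittingTime, lintegral_walkLaw _ _ (measurable_firstVisit j)]
  simp only [firstVisit_consPath_of_ne h]
  simp only [lintegral_add_left measurable_const, lintegral_const,
    measure_univ, mul_one, mul_add, Finset.sum_add_distrib, G.sum_ofReal_transition]
  rfl

/-- A nonnegative supersolution of the first-step equations bounds the hitting times. -/
theorem hittingTime_le (j : Fin n) (g : Fin n → ℝ≥0∞)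
    (hg : ∀ i, i ≠ j → 1 + ∑ k, ENNReal.ofReal (G.transition i k) * g k ≤ g i) (i : Fin n) :
    G.hittingTime i j ≤ g i := by
  -- Truncating at `m` makes the first-step recursion an induction on `m`; monotone convergence then
  -- removes the truncation.
  have hm : ∀ (m : ℕ) (i : Fin n), ∫⁻ ω, min (firstVisit j ω) m ∂(G.walkLaw i) ≤ g i := by
    intro m
    induction m with
    | zero => simp
    | succ m ih =>
      intro i
      rw [lintegral_walkLaw _ _ ((measurable_firstVisit j).min measurable_const)]
      by_cases h : i = j
      · subst h
        simp [firstVisit_consPath_self]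
      · refine le_trans ?_ (hg i h)
        have : ∀ ω, min (firstVisit j (consPath i ω)) ((m + 1 : ℕ) : ℝ≥0∞) =
            1 + min (firstVisit j ω) m := by
          intro ω
          rw [firstVisit_consPath_of_ne h, Nat.cast_succ, add_comm (m : ℝ≥0∞), min_add_add_left]
        simp only [this, lintegral_add_left measurable_const, lintegral_const,
          measure_univ, mul_one, mul_add, Finset.sum_add_distrib, G.sum_ofReal_transition]
        gcongr with k _
        exact ih k
  have hsup : ∀ ω : ℕ → Fin n, firstVisit j ω = ⨆ m : ℕ, min (firstVisit j ω) m := by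
    intro ω
    rw [← inf_iSup_eq, ENNReal.iSup_natCast, inf_top_eq]
  rw [hittingTime, lintegral_congr hsup, lintegral_iSup]
  · exact iSup_le fun m => hm m i
  · exact fun m => (measurable_firstVisit j).min measurable_const
  · exact fun a b hab ω => min_le_min_left _ (Nat.cast_le.2 hab)

end StronglyConnectedDigraph

namespace StronglyConnectedDigraph

variable {n : ℕ} (G : StronglyConnectedDigraph n)

theorem transition_pos_iff {i j : Fin n} : 0 < G.transition i j ↔ 0 < G.weight i j := by
  simp [transition, div_pos_iff_of_pos_right (G.degree_pos i)]

/-! ### Stationary distributions -/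

/-- A nonnegative left eigenvector for the eigenvalue one that is positive somewhere is positive
everywhere. -/
theorem pos_of_vecMul_transition {p : Fin n → ℝ} (hp : Matrix.vecMul p G.transition = p)
    (h0 : ∀ i, 0 ≤ p i) {i : Fin n} (hi : 0 < p i) (j : Fin n) : 0 < p j := by
  have step : ∀ a b, 0 < G.weight a b → 0 < p a → 0 < p b := by
    intro a b hab ha
    rw [← congrFun hp b]
    exact lt_of_lt_of_le (mul_pos ha (G.transition_pos_iff.2 hab))
      (Finset.single_le_sum (f := fun k => p k * G.transition k b)
        (fun k _ => mul_nonneg (h0 k) (G.transition_nonneg k b)) (Finset.mem_univ a))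
  induction G.connected i j with
  | single h => exact step _ _ h hi
  | tail _ h ih => exact step _ _ h ih

theorem sum_vecMul_transition (p : Fin n → ℝ) :
    ∑ j, Matrix.vecMul p G.transition j = ∑ i, p i := by
  simp only [Matrix.vecMul, dotProduct]
  rw [Finset.sum_comm]
  simp only [← Finset.mul_sum, sum_transition, mul_one]

/-- The triangle inequality gives `|p| ≤ |p|P` entrywise, and both sides have the same total because
the rows of `P` sum to one. -/
theorem vecMul_transition_abs {p : Fin n → ℝ} (hp : Matrix.vecMul p G.transition = p) :
    Matrix.vecMul |p| G.transition = |p| := by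
  have hle : ∀ j ∈ Finset.univ, |p| j ≤ Matrix.vecMul |p| G.transition j := by
    intro j _
    rw [Pi.abs_apply, ← congrFun hp j]
    simp only [Matrix.vecMul, dotProduct]
    refine (Finset.abs_sum_le_sum_abs (fun i => p i * G.transition i j) _).trans
      (Finset.sum_le_sum fun i _ => ?_)
    rw [abs_mul, abs_of_nonneg (G.transition_nonneg i j)]
    rfl
  have := (Finset.sum_eq_sum_iff_of_le hle).1 (G.sum_vecMul_transition |p|).symm
  exact funext fun j => (this j (Finset.mem_univ j)).symm

/-- `1 - P` kills the constants, so it is singular and has a left kernel vector; normalize its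
absolute value. -/
theorem exists_isStationary [Nonempty (Fin n)] : ∃ p, G.IsStationary p := by
  have hdet : (1 - G.transition).det = 0 := by
    refine Matrix.exists_mulVec_eq_zero_iff.1 ⟨1, one_ne_zero, ?_⟩
    ext i
    rw [Matrix.sub_mulVec, Matrix.one_mulVec]
    simp [Matrix.mulVec, dotProduct, sum_transition]
  obtain ⟨p, hp0, hp⟩ := Matrix.exists_vecMul_eq_zero_iff.2 hdet
  rw [Matrix.vecMul_sub, Matrix.vecMul_one, sub_eq_zero] at hp
  have habs := G.vecMul_transition_abs hp.symm
  have hpos : 0 < ∑ i, |p| i := by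
    obtain ⟨i, hi⟩ := Function.ne_iff.1 hp0
    exact Finset.sum_pos' (fun i _ => abs_nonneg _) ⟨i, Finset.mem_univ i, abs_pos.2 hi⟩
  refine ⟨(∑ i, |p| i)⁻¹ • |p|, ?_, ?_⟩
  · rw [Matrix.smul_vecMul, habs]
  · simp only [Pi.smul_apply, smul_eq_mul, ← Finset.mul_sum]
    exact inv_mul_cancel₀ hpos.ne'

theorem IsStationary.pos {p : Fin n → ℝ} (hp : G.IsStationary p) (i : Fin n) : 0 < p i := by
  have habs := G.vecMul_transition_abs hp.1
  -- Stationarity does not presuppose nonnegativity. If `p k < 0`, this nonnegative eigenvector is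
  -- positive at `k`, hence everywhere, so all entries of `p` are negative and cannot sum to one.
  have hsub : Matrix.vecMul (|p| - p) G.transition = |p| - p := by
    rw [Matrix.sub_vecMul, habs, hp.1]
  have hnonneg : ∀ i, 0 ≤ p i := by
    by_contra! hcon
    obtain ⟨k, hk⟩ := hcon
    have hall := G.pos_of_vecMul_transition hsub (fun i => sub_nonneg.2 (le_abs_self (p i)))
      (i := k) (sub_pos.2 (hk.trans_le (abs_nonneg (p k))))
    have : ∑ i, p i ≤ 0 := Finset.sum_nonpos fun j _ => by
      have := hall j
      simp only [Pi.sub_apply, Pi.abs_apply, sub_pos] at this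
      by_contra! hj
      exact this.ne (abs_of_pos hj).symm
    linarith [hp.2]
  obtain ⟨k, -, hk⟩ : ∃ k ∈ Finset.univ, p k ≠ 0 := Finset.exists_ne_zero_of_sum_ne_zero
    (by rw [hp.2]; exact one_ne_zero)
  exact G.pos_of_vecMul_transition hp.1 hnonneg (lt_of_le_of_ne (hnonneg k) hk.symm) i

theorem isStationary_stationary [Nonempty (Fin n)] : G.IsStationary G.stationary :=
  Classical.epsilon_spec G.exists_isStationary

theorem stationary_pos [Nonempty (Fin n)] (i : Fin n) : 0 < G.stationary i :=
  IsStationary.pos G G.isStationary_stationary i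

theorem volume_pos [Nonempty (Fin n)] : 0 < G.volume :=
  Finset.sum_pos (fun i _ => G.degree_pos i) Finset.univ_nonempty

/-! ### The Laplacian -/

theorem laplacian_mulVec_apply (x : Fin n → ℝ) (i : Fin n) :
    G.laplacian.mulVec x i =
      G.volume * (G.stationary i * (x i - ∑ k, G.transition i k * x k)) := by
  rw [laplacian, Matrix.smul_mulVec, ← Matrix.mulVec_mulVec, Pi.smul_apply,
    Matrix.mulVec_diagonal, Matrix.sub_mulVec, Matrix.one_mulVec]
  rfl

theorem laplacian_mulVec_one : G.laplacian.mulVec 1 = 0 := by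
  ext i
  simp [laplacian_mulVec_apply, sum_transition]

theorem one_vecMul_laplacian [Nonempty (Fin n)] : Matrix.vecMul 1 G.laplacian = 0 := by
  have h1 : Matrix.vecMul 1 (Matrix.diagonal G.stationary) = G.stationary := by
    ext i; simp [Matrix.vecMul_diagonal]
  rw [laplacian, Matrix.vecMul_smul, ← Matrix.vecMul_vecMul, h1, Matrix.vecMul_sub,
    G.isStationary_stationary.1]
  simp

/-- Maximum principle: a harmonic function equals its maximum at every out-neighbour of a maximizer,
hence everywhere by strong connectivity. -/
theorem eq_const_of_laplacian_mulVec_eq_zero [Nonempty (Fin n)] {x : Fin n → ℝ}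
    (hx : G.laplacian.mulVec x = 0) (i j : Fin n) : x i = x j := by
  have hharm : ∀ i, x i = ∑ k, G.transition i k * x k := by
    intro i
    have := congrFun hx i
    rw [laplacian_mulVec_apply, Pi.zero_apply] at this
    have h2 := (mul_eq_zero.1 ((mul_eq_zero.1 this).resolve_left G.volume_pos.ne')).resolve_left
      (G.stationary_pos i).ne'
    linarith
  obtain ⟨m, hm⟩ := Finite.exists_max x
  have step : ∀ a b, 0 < G.weight a b → x a = x m → x b = x m := by
    intro a b hab ha
    by_contra hb
    have hlt : x b < x m := lt_of_le_of_ne (hm b) hb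
    have : ∑ k, G.transition a k * x k < ∑ k, G.transition a k * x m :=
      Finset.sum_lt_sum (fun k _ => mul_le_mul_of_nonneg_left (hm k) (G.transition_nonneg a k))
        ⟨b, Finset.mem_univ b, mul_lt_mul_of_pos_left hlt (G.transition_pos_iff.2 hab)⟩
    rw [← Finset.sum_mul, sum_transition, one_mul, ← hharm, ha] at this
    exact lt_irrefl _ this
  have hall : ∀ j, x j = x m := by
    intro j
    induction G.connected m j with
    | single h => exact step _ _ h rfl
    | tail _ h ih => exact step _ _ h ih
  rw [hall i, hall j]

/-- The unit vector with constant entries. -/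
noncomputable def unitConst (n : ℕ) : Fin n → ℝ := (√n)⁻¹ • 1

theorem vecMulVec_unitConst (i j : Fin n) :
    Matrix.vecMulVec (unitConst n) (unitConst n) i j = 1 / n := by
  simp only [unitConst, Matrix.vecMulVec_apply, Pi.smul_apply, Pi.one_apply, smul_eq_mul, mul_one]
  rw [← mul_inv, Real.mul_self_sqrt (Nat.cast_nonneg n), one_div]

theorem unitConst_dotProduct_self [Nonempty (Fin n)] : unitConst n ⬝ᵥ unitConst n = 1 := by
  have hn : (n : ℝ) ≠ 0 := Nat.cast_ne_zero.2 (Fin.pos_iff_nonempty.2 ‹_›).ne'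
  have : ∀ i, unitConst n i * unitConst n i = 1 / n := fun i => vecMulVec_unitConst i i
  simp [dotProduct, this, hn]

theorem exists_invertsOffVector_laplacian [Nonempty (Fin n)] :
    ∃ M, InvertsOffVector G.laplacian M (unitConst n) := by
  set v := unitConst n with hv
  set E := Matrix.vecMulVec v v with hE
  have hvv : v ⬝ᵥ v = 1 := unitConst_dotProduct_self
  have hLv : G.laplacian.mulVec v = 0 := by
    rw [hv, unitConst, Matrix.mulVec_smul, laplacian_mulVec_one, smul_zero]
  have hvL : Matrix.vecMul v G.laplacian = 0 := by
    rw [hv, unitConst, Matrix.smul_vecMul, one_vecMul_laplacian, smul_zero]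
  have hEv : E.mulVec v = v := by
    rw [hE, Matrix.vecMulVec_mulVec, hvv]; simp
  have hvE : Matrix.vecMul v E = v := by
    rw [hE, Matrix.vecMul_vecMulVec, hvv]; simp
  -- Pairing `(L + E)x = 0` with `v` gives `v ⬝ᵥ x = 0`, hence `Lx = 0`; then `x` is constant and
  -- orthogonal to the constants.
  have hdet : (G.laplacian + E).det ≠ 0 := by
    intro h0
    obtain ⟨x, hx0, hx⟩ := Matrix.exists_mulVec_eq_zero_iff.2 h0
    have h1 : v ⬝ᵥ x = 0 := by
      have := congrArg (fun y => v ⬝ᵥ y) hx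
      simpa [Matrix.dotProduct_mulVec, Matrix.vecMul_add, hvL, hvE] using this
    have h2 : G.laplacian.mulVec x = 0 := by
      rw [Matrix.add_mulVec, hE, Matrix.vecMulVec_mulVec, h1] at hx
      simpa using hx
    have hconst := G.eq_const_of_laplacian_mulVec_eq_zero h2
    obtain ⟨i⟩ := ‹Nonempty (Fin n)›
    have hxi : x = x i • 1 := by ext j; simp [hconst j i]
    have hn : (0 : ℝ) < n := Nat.cast_pos.2 (Fin.pos_iff_nonempty.2 ⟨i⟩)
    rw [hxi, hv, unitConst] at h1
    simp only [smul_dotProduct, dotProduct_smul, one_dotProduct_one, Fintype.card_fin,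
      smul_eq_mul, mul_eq_zero, inv_eq_zero, Real.sqrt_ne_zero'.2 hn, hn.ne', or_false] at h1
    exact hx0 (by rw [hxi, h1, zero_smul])
  have hu : IsUnit (G.laplacian + E).det := isUnit_iff_ne_zero.2 hdet
  set B := G.laplacian + E with hB
  have hBv : B.mulVec v = v := by rw [hB, Matrix.add_mulVec, hLv, hEv, zero_add]
  have hvB : Matrix.vecMul v B = v := by rw [hB, Matrix.vecMul_add, hvL, hvE, zero_add]
  have hBiv : B⁻¹.mulVec v = v := by
    conv_lhs => rw [← hBv]
    rw [Matrix.mulVec_mulVec, Matrix.nonsing_inv_mul _ hu, Matrix.one_mulVec]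
  have hvBi : Matrix.vecMul v B⁻¹ = v := by
    conv_lhs => rw [← hvB]
    rw [Matrix.vecMul_vecMul, Matrix.mul_nonsing_inv _ hu, Matrix.vecMul_one]
  have hL : G.laplacian = B - E := by rw [hB, add_sub_cancel_right]
  refine ⟨B⁻¹ - E, hvv, hLv, hvL, ?_, ?_, ?_, ?_⟩
  · rw [Matrix.sub_mulVec, hBiv, hEv, sub_self]
  · rw [Matrix.vecMul_sub, hvBi, hvE, sub_self]
  · rw [mul_sub, hE, Matrix.mul_vecMulVec, hLv, hL, sub_mul, Matrix.mul_nonsing_inv _ hu,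
      hE, Matrix.vecMulVec_mul, hvBi]
    simp
  · rw [sub_mul, hE, Matrix.vecMulVec_mul, hvL, hL, mul_sub, Matrix.nonsing_inv_mul _ hu,
      hE, Matrix.mul_vecMulVec, hBiv]
    simp

end StronglyConnectedDigraph

/-! ### Solving Poisson equations for the Laplacian -/

namespace StronglyConnectedDigraph

variable {n : ℕ} (G : StronglyConnectedDigraph n)

theorem sum_laplacian_mulVec [Nonempty (Fin n)] (x : Fin n → ℝ) :
    ∑ i, G.laplacian.mulVec x i = 0 := by
  rw [← one_dotProduct, Matrix.dotProduct_mulVec, one_vecMul_laplacian, zero_dotProduct]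

variable {G} {M : Matrix (Fin n) (Fin n) ℝ}

theorem sub_eq_of_laplacian_mulVec (hM : InvertsOffVector G.laplacian M (unitConst n))
    {x w : Fin n → ℝ} (hx : G.laplacian.mulVec x = w) (i j : Fin n) :
    x i - x j = M.mulVec w i - M.mulVec w j := by
  rw [← hx, Matrix.mulVec_mulVec, hM.inv_mul_eq, Matrix.sub_mulVec, Matrix.one_mulVec,
    Matrix.vecMulVec_mulVec]
  simp [unitConst]

theorem laplacian_mulVec_mulVec (hM : InvertsOffVector G.laplacian M (unitConst n))
    {w : Fin n → ℝ} (hw : ∑ i, w i = 0) : G.laplacian.mulVec (M.mulVec w) = w := by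
  have : unitConst n ⬝ᵥ w = 0 := by
    rw [unitConst, smul_dotProduct, one_dotProduct, hw, smul_zero]
  rw [Matrix.mulVec_mulVec, hM.mul_eq, Matrix.sub_mulVec, Matrix.one_mulVec,
    Matrix.vecMulVec_mulVec, this]
  simp

theorem sum_row_eq_zero [Nonempty (Fin n)] (hM : InvertsOffVector G.laplacian M (unitConst n))
    (i : Fin n) : ∑ j, M i j = 0 := by
  have hn : (0 : ℝ) < n := Nat.cast_pos.2 (Fin.pos_iff_nonempty.2 ‹_›)
  have := congrFun hM.inv_mulVec_eq i
  rw [unitConst, Matrix.mulVec_smul, Pi.smul_apply, Pi.zero_apply, smul_eq_zero] at this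
  simpa [Matrix.mulVec, dotProduct_one] using
    this.resolve_left (inv_ne_zero (Real.sqrt_ne_zero'.2 hn))

/-! ### Resistances -/

/-- The reaching probability is harmonic off `i` and `j`, and the first step from `i` gives the
value at `i`. The value at `j` needs no computation: the entries of `Lh` sum to zero. -/
theorem laplacian_mulVec_reachProb [Nonempty (Fin n)] {i j : Fin n} (hij : i ≠ j) :
    G.laplacian.mulVec (G.reachProb i j) =
      (G.volume * G.stationary i * G.escapeProb i j) • (Pi.single j 1 - Pi.single i 1) := by
  set c := G.volume * G.stationary i * G.escapeProb i j with hc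
  have hi : G.laplacian.mulVec (G.reachProb i j) i = -c := by
    rw [laplacian_mulVec_apply, reachProb_source _ hij, ← escapeProb_eq_sum, hc]
    ring
  have hk : ∀ k, k ≠ i → k ≠ j → G.laplacian.mulVec (G.reachProb i j) k = 0 := by
    intro k hki hkj
    rw [laplacian_mulVec_apply, reachProb_of_ne _ hki hkj, sub_self, mul_zero, mul_zero]
  have hsum := G.sum_laplacian_mulVec (G.reachProb i j)
  rw [Fintype.sum_eq_add i j hij fun k hk' => hk k hk'.1 hk'.2, hi] at hsum
  ext k
  by_cases hki : k = i
  · subst hki; simp [hi, hij]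
  · by_cases hkj : k = j
    · subst hkj; simp [hki]; linarith
    · simp [hk k hki hkj, hki, hkj]

theorem resistance_eq [Nonempty (Fin n)] (hM : InvertsOffVector G.laplacian M (unitConst n))
    (i j : Fin n) : G.resistance i j = M i i + M j j - M i j - M j i := by
  by_cases hij : i = j
  · subst hij; simp [resistance]
  · have h := sub_eq_of_laplacian_mulVec hM (laplacian_mulVec_reachProb hij) j i
    rw [reachProb_target, reachProb_source _ hij] at h
    simp only [Matrix.mulVec_smul, Matrix.mulVec_sub, Matrix.mulVec_single_one, Pi.smul_apply,
      Pi.sub_apply, Matrix.col_apply, smul_eq_mul] at h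
    rw [resistance, if_neg hij, eq_comm]
    -- The product being `1` already forces the denominator to be nonzero, so positivity of the
    -- escape probability need not be shown separately.
    apply eq_one_div_of_mul_eq_one_right
    linarith

/-- The formula through `M` shows that `Ω` is symmetric, and it vanishes on the diagonal, so the sum
is half the full double sum. Weights `1` and `π` give the two Kirchhoff indices. -/
theorem sum_mul_resistance [Nonempty (Fin n)]
    (hM : InvertsOffVector G.laplacian M (unitConst n)) (a : Fin n → ℝ) :
    ∑ i, ∑ j ∈ Finset.Ioi i, a i * a j * G.resistance i j =
      (∑ i, a i) * ∑ i, a i * M i i - a ⬝ᵥ M.mulVec a := by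
  have hsymm : ∀ i j, a j * a i * G.resistance j i = a i * a j * G.resistance i j := by
    intro i j
    rw [resistance_eq hM, resistance_eq hM]; ring
  have h2 := Finset.sum_sum_Ioi_add_eq_sum_sum_off_diag
    (fun i j => a i * a j * G.resistance i j)
  have h3 : ∀ i, ∑ j ∈ ({i} : Finset (Fin n))ᶜ, a j * a i * G.resistance j i =
      ∑ j, a i * a j * G.resistance i j := by
    intro i
    rw [Fintype.sum_eq_add_sum_compl i]
    simp only [hsymm i]
    simp [resistance]
  simp only [h3] at h2
  simp only [hsymm, ← two_mul, ← Finset.mul_sum] at h2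
  have h4 : ∑ i, ∑ j, a i * a j * G.resistance i j =
      2 * ((∑ i, a i) * ∑ i, a i * M i i - a ⬝ᵥ M.mulVec a) := by
    have e1 : ∑ i, ∑ j, a i * a j * M i i = (∑ i, a i) * ∑ i, a i * M i i := by
      rw [mul_comm, Finset.sum_mul_sum]
      exact Finset.sum_congr rfl fun i _ => Finset.sum_congr rfl fun j _ => by ring
    have e2 : ∑ i, ∑ j, a i * a j * M j j = (∑ i, a i) * ∑ i, a i * M i i := by
      rw [Finset.sum_mul_sum]
      exact Finset.sum_congr rfl fun i _ => Finset.sum_congr rfl fun j _ => by ring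
    have e3 : ∑ i, ∑ j, a i * a j * M i j = a ⬝ᵥ M.mulVec a := by
      simp only [dotProduct, Matrix.mulVec, Finset.mul_sum]
      exact Finset.sum_congr rfl fun i _ => Finset.sum_congr rfl fun j _ => by ring
    have e4 : ∑ i, ∑ j, a i * a j * M j i = a ⬝ᵥ M.mulVec a := by
      rw [Finset.sum_comm, ← e3]
      exact Finset.sum_congr rfl fun i _ => Finset.sum_congr rfl fun j _ => by ring
    have : ∀ i j, a i * a j * G.resistance i j =
        a i * a j * M i i + a i * a j * M j j - a i * a j * M i j - a i * a j * M j i := by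
      intro i j; rw [resistance_eq hM]; ring
    simp only [this, Finset.sum_sub_distrib, Finset.sum_add_distrib, e1, e2, e3, e4]
    ring
  linarith

theorem kirchhoff_eq [Nonempty (Fin n)] (hM : InvertsOffVector G.laplacian M (unitConst n)) :
    G.kirchhoff = n * M.trace := by
  have h := sum_mul_resistance hM 1
  have h0 : M.mulVec 1 = 0 := by
    ext i; simpa [Matrix.mulVec, dotProduct_one] using sum_row_eq_zero hM i
  simpa [h0, Matrix.trace, kirchhoff] using h

theorem mulKirchhoff_eq [Nonempty (Fin n)] (hM : InvertsOffVector G.laplacian M (unitConst n)) :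
    G.mulKirchhoff = G.volume ^ 2 *
      (∑ i, G.stationary i * M i i - G.stationary ⬝ᵥ M.mulVec G.stationary) := by
  rw [mulKirchhoff, sum_mul_resistance hM, G.isStationary_stationary.2, one_mul]

/-! ### Hitting times -/

/-- The hitting times of `j`, in terms of an inverse of the Laplacian off the constants. -/
noncomputable def hittingPotential (G : StronglyConnectedDigraph n) (M : Matrix (Fin n) (Fin n) ℝ)
    (j i : Fin n) : ℝ :=
  G.volume * (M.mulVec G.stationary i - M i j - M.mulVec G.stationary j + M j j)

theorem hittingPotential_self (j : Fin n) : hittingPotential G M j j = 0 := by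
  rw [hittingPotential]; ring

theorem laplacian_mulVec_hittingPotential [Nonempty (Fin n)]
    (hM : InvertsOffVector G.laplacian M (unitConst n)) (j : Fin n) :
    G.laplacian.mulVec (hittingPotential G M j) =
      G.volume • (G.stationary - Pi.single j 1) := by
  have hdec : hittingPotential G M j = M.mulVec (G.volume • (G.stationary - Pi.single j 1)) +
      (G.volume * (M j j - M.mulVec G.stationary j)) • (1 : Fin n → ℝ) := by
    ext i
    simp only [hittingPotential, Matrix.mulVec_smul, Matrix.mulVec_sub, Matrix.mulVec_single_one,
      Pi.add_apply, Pi.smul_apply, Pi.sub_apply, Matrix.col_apply, smul_eq_mul, Pi.one_apply]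
    ring
  rw [hdec, Matrix.mulVec_add, laplacian_mulVec_mulVec hM, Matrix.mulVec_smul,
    laplacian_mulVec_one, smul_zero, add_zero]
  simp [← Finset.mul_sum, G.isStationary_stationary.2]

theorem hittingPotential_of_ne [Nonempty (Fin n)]
    (hM : InvertsOffVector G.laplacian M (unitConst n)) {i j : Fin n} (hij : i ≠ j) :
    hittingPotential G M j i = 1 + ∑ k, G.transition i k * hittingPotential G M j k := by
  have h := congrFun (laplacian_mulVec_hittingPotential hM j) i
  rw [laplacian_mulVec_apply] at h
  have hv := G.volume_pos.ne'
  have hp := (G.stationary_pos i).ne'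
  simp only [Pi.smul_apply, Pi.sub_apply, Pi.single_apply, if_neg hij, sub_zero, smul_eq_mul] at h
  have h2 := mul_left_cancel₀ hv h
  have h3 := mul_left_cancel₀ hp (h2.trans (mul_one _).symm)
  linarith

/-- Minimum principle: at a minimizer other than `j` the value would be at least itself plus one. -/
theorem hittingPotential_nonneg [Nonempty (Fin n)]
    (hM : InvertsOffVector G.laplacian M (unitConst n)) (j i : Fin n) :
    0 ≤ hittingPotential G M j i := by
  obtain ⟨m, hm⟩ := Finite.exists_min (hittingPotential G M j)
  by_cases hmj : m = j
  · rw [← hittingPotential_self (G := G) (M := M) j, ← hmj]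
    exact hmj ▸ hm i
  · have h := hittingPotential_of_ne hM hmj
    have : ∑ k, G.transition m k * hittingPotential G M j m ≤
        ∑ k, G.transition m k * hittingPotential G M j k :=
      Finset.sum_le_sum fun k _ => mul_le_mul_of_nonneg_left (hm k) (G.transition_nonneg m k)
    rw [← Finset.sum_mul, sum_transition, one_mul] at this
    linarith

theorem sum_ofReal_transition_mul {x : Fin n → ℝ} (hx : ∀ k, 0 ≤ x k) (i : Fin n) :
    ∑ k, ENNReal.ofReal (G.transition i k) * ENNReal.ofReal (x k) =
      ENNReal.ofReal (∑ k, G.transition i k * x k) := by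
  rw [ENNReal.ofReal_sum_of_nonneg fun k _ => mul_nonneg (G.transition_nonneg i k) (hx k)]
  exact Finset.sum_congr rfl fun k _ => (ENNReal.ofReal_mul (G.transition_nonneg i k)).symm

/-- The nonnegative potential solves the first-step equations, so it is a finite supersolution. -/
theorem hittingTime_ne_top [Nonempty (Fin n)]
    (hM : InvertsOffVector G.laplacian M (unitConst n)) (i j : Fin n) :
    G.hittingTime i j ≠ ⊤ := by
  refine ne_top_of_le_ne_top ENNReal.ofReal_ne_top
    (G.hittingTime_le j (fun i => ENNReal.ofReal (hittingPotential G M j i)) ?_ i)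
  intro i hij
  have hnn := hittingPotential_nonneg hM j
  rw [sum_ofReal_transition_mul hnn, hittingPotential_of_ne hM hij,
    ENNReal.ofReal_add zero_le_one
      (Finset.sum_nonneg fun k _ => mul_nonneg (G.transition_nonneg i k) (hnn k)),
    ENNReal.ofReal_one]

theorem toReal_hittingTime [Nonempty (Fin n)]
    (hM : InvertsOffVector G.laplacian M (unitConst n)) (i j : Fin n) :
    (G.hittingTime i j).toReal = hittingPotential G M j i := by
  have hfin := hittingTime_ne_top hM
  -- With finiteness known, the difference of the two solutions makes sense. It is harmonic off `j`,
  -- hence also at `j` because `L` has zero column sums, so it is constant; it vanishes at `j`.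
  set f : Fin n → ℝ := fun k => (G.hittingTime k j).toReal - hittingPotential G M j k with hf
  have hfj : f j = 0 := by simp [hf, hittingTime_self, hittingPotential_self]
  have hfk : ∀ k, k ≠ j → G.laplacian.mulVec f k = 0 := by
    intro k hk
    have h1 : (G.hittingTime k j).toReal =
        1 + ∑ l, G.transition k l * (G.hittingTime l j).toReal := by
      have hprod : ∀ l, ENNReal.ofReal (G.transition k l) * G.hittingTime l j ≠ ⊤ :=
        fun l => ENNReal.mul_ne_top ENNReal.ofReal_ne_top (hfin l j)
      rw [hittingTime_of_ne _ hk, ENNReal.toReal_add ENNReal.one_ne_top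
        (ENNReal.sum_ne_top.2 fun l _ => hprod l), ENNReal.toReal_sum fun l _ => hprod l]
      simp [ENNReal.toReal_mul, ENNReal.toReal_ofReal (G.transition_nonneg _ _)]
    have h2 := hittingPotential_of_ne hM hk
    have h3 : f k = ∑ l, G.transition k l * f l := by
      simp only [hf, mul_sub, Finset.sum_sub_distrib]
      linarith
    rw [laplacian_mulVec_apply, ← h3, sub_self, mul_zero, mul_zero]
  have hsum := G.sum_laplacian_mulVec f
  rw [Fintype.sum_eq_single j hfk] at hsum
  have hL : G.laplacian.mulVec f = 0 := by
    ext k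
    by_cases hk : k = j
    · rw [hk, hsum, Pi.zero_apply]
    · rw [hfk k hk, Pi.zero_apply]
  have := G.eq_const_of_laplacian_mulVec_eq_zero hL i j
  rw [hfj] at this
  exact sub_eq_zero.1 this

theorem kemeny_ne_top [Nonempty (Fin n)] (i : Fin n) : G.kemeny i ≠ ⊤ := by
  obtain ⟨M, hM⟩ := G.exists_invertsOffVector_laplacian
  exact ENNReal.sum_ne_top.2 fun j _ =>
    ENNReal.mul_ne_top ENNReal.ofReal_ne_top (hittingTime_ne_top hM i j)

theorem mulKirchhoff_eq_volume_mul_kemeny [Nonempty (Fin n)] (i : Fin n) :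
    G.mulKirchhoff = G.volume * (G.kemeny i).toReal := by
  obtain ⟨M, hM⟩ := G.exists_invertsOffVector_laplacian
  rw [mulKirchhoff_eq hM, kemeny, ENNReal.toReal_sum fun j _ =>
    ENNReal.mul_ne_top ENNReal.ofReal_ne_top (hittingTime_ne_top hM i j)]
  simp only [ENNReal.toReal_mul, ENNReal.toReal_ofReal (G.stationary_pos _).le,
    toReal_hittingTime hM]
  -- After summation over `j`, the first two terms both become `(Mπ)_i` and cancel: this is the
  -- independence of the starting vertex.
  have hterm : ∀ j, G.stationary j * hittingPotential G M j i =
      G.volume * (G.stationary j * M.mulVec G.stationary i - M i j * G.stationary j -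
        G.stationary j * M.mulVec G.stationary j + G.stationary j * M j j) := by
    intro j; rw [hittingPotential]; ring
  have hrow : ∑ j, M i j * G.stationary j = M.mulVec G.stationary i := rfl
  have hquad : ∑ j, G.stationary j * M.mulVec G.stationary j =
    G.stationary ⬝ᵥ M.mulVec G.stationary := rfl
  simp only [hterm, ← Finset.mul_sum, Finset.sum_add_distrib, Finset.sum_sub_distrib,
    ← Finset.sum_mul, G.isStationary_stationary.2, hrow, hquad]
  ring

/-! ### The normalized Laplacian -/

theorem exists_invertsOffVector_normalizedLaplacian [Nonempty (Fin n)]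
    (hM : InvertsOffVector G.laplacian M (unitConst n)) :
    ∃ N, InvertsOffVector G.normalizedLaplacian N (fun i => √(G.stationary i)) ∧
      N.trace = G.volume *
        (∑ i, G.stationary i * M i i - G.stationary ⬝ᵥ M.mulVec G.stationary) := by
  have hd := G.volume_pos
  have hsd : √G.volume ≠ 0 := Real.sqrt_ne_zero'.2 hd
  have hsp : ∀ i, √(G.stationary i) ≠ 0 := fun i => Real.sqrt_ne_zero'.2 (G.stationary_pos i)
  have hsq : ∀ i, √(G.stationary i) * √(G.stationary i) = G.stationary i :=
    fun i => Real.mul_self_sqrt (G.stationary_pos i).le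
  have hdsq : √G.volume * √G.volume = G.volume := Real.mul_self_sqrt hd.le
  set v : Fin n → ℝ := fun i => √(G.stationary i) with hv
  set S : Matrix (Fin n) (Fin n) ℝ :=
    Matrix.diagonal (fun i => (√(G.stationary i))⁻¹ / √G.volume) with hS
  set T : Matrix (Fin n) (Fin n) ℝ :=
    Matrix.diagonal (fun i => √(G.stationary i) * √G.volume) with hT
  set E := Matrix.vecMulVec v v with hE
  set F := Matrix.vecMulVec (unitConst n) (unitConst n) with hF
  have hN : G.normalizedLaplacian = S * G.laplacian * S := rfl
  have hST : S * T = 1 := by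
    rw [hS, hT, Matrix.diagonal_mul_diagonal, ← Matrix.diagonal_one]
    congr 1; ext i
    field_simp [hsp i]
  have hTS : T * S = 1 := mul_eq_one_comm.1 hST
  have hvv : v ⬝ᵥ v = 1 := by simp [dotProduct, hv, hsq, G.isStationary_stationary.2]
  have hSv : S.mulVec v = (√G.volume)⁻¹ • 1 := by
    ext i
    simp only [hS, hv, Matrix.mulVec_diagonal, Pi.smul_apply, Pi.one_apply, smul_eq_mul]
    field_simp [hsp i]
  have hvS : Matrix.vecMul v S = (√G.volume)⁻¹ • 1 := by
    rw [← hSv, ← Matrix.mulVec_transpose, hS, Matrix.diagonal_transpose]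
  have hLSv : G.laplacian.mulVec (S.mulVec v) = 0 := by
    rw [hSv, Matrix.mulVec_smul, laplacian_mulVec_one, smul_zero]
  have hvSL : Matrix.vecMul (Matrix.vecMul v S) G.laplacian = 0 := by
    rw [hvS, Matrix.smul_vecMul, one_vecMul_laplacian, smul_zero]
  have hTc : T.mulVec (unitConst n) = ((√n)⁻¹ * √G.volume) • v := by
    ext i
    simp only [hT, hv, Matrix.mulVec_diagonal, unitConst, Pi.smul_apply, Pi.one_apply, smul_eq_mul]
    ring
  have hcT : Matrix.vecMul (unitConst n) T = ((√n)⁻¹ * √G.volume) • v := by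
    rw [← hTc, ← Matrix.mulVec_transpose, hT, Matrix.diagonal_transpose]
  have hEE : E * E = E := by
    rw [hE, Matrix.vecMulVec_mul_vecMulVec, hvv, one_smul]
  have hvQ : Matrix.vecMul v (1 - E) = 0 := by
    rw [Matrix.vecMul_sub, Matrix.vecMul_one, hE, Matrix.vecMul_vecMulVec, hvv]; simp
  have hQv : (1 - E).mulVec v = 0 := by
    rw [Matrix.sub_mulVec, Matrix.one_mulVec, hE, Matrix.vecMulVec_mulVec, hvv]; simp
  have hNv : G.normalizedLaplacian.mulVec v = 0 := by
    rw [hN, ← Matrix.mulVec_mulVec, ← Matrix.mulVec_mulVec, hLSv, Matrix.mulVec_zero]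
  have hvN : Matrix.vecMul v G.normalizedLaplacian = 0 := by
    rw [hN, ← Matrix.vecMul_vecMul, ← Matrix.vecMul_vecMul, hvSL, Matrix.zero_vecMul]
  have hNQ : G.normalizedLaplacian * (1 - E) = G.normalizedLaplacian := by
    rw [mul_sub, hE, Matrix.mul_vecMulVec, hNv]; simp
  have hQN : (1 - E) * G.normalizedLaplacian = G.normalizedLaplacian := by
    rw [sub_mul, hE, Matrix.vecMulVec_mul, hvN]; simp
  have hFTQ : F * (T * (1 - E)) = 0 := by
    rw [hF, Matrix.vecMulVec_mul, ← Matrix.vecMul_vecMul, hcT, Matrix.smul_vecMul, hvQ]; simp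
  have hQTF : (1 - E) * T * F = 0 := by
    rw [hF, Matrix.mul_vecMulVec, ← Matrix.mulVec_mulVec, hTc, Matrix.mulVec_smul, hQv]; simp
  -- With `T = S⁻¹`, `T M T` inverts `S L S` only up to rank-one errors, since congruence by `S`
  -- does not preserve orthogonality. Compressing by the projection off `√π` removes them, because
  -- `T` maps the constants to multiples of `√π`.
  refine ⟨(1 - E) * (T * M * T) * (1 - E), ⟨hvv, hNv, hvN, ?_, ?_, ?_, ?_⟩, ?_⟩
  · rw [← Matrix.mulVec_mulVec, hQv, Matrix.mulVec_zero]
  · rw [mul_assoc, ← Matrix.vecMul_vecMul, hvQ, Matrix.zero_vecMul]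
  · calc G.normalizedLaplacian * ((1 - E) * (T * M * T) * (1 - E))
        = (G.normalizedLaplacian * (1 - E)) * (T * M * T) * (1 - E) := by simp only [mul_assoc]
      _ = S * G.laplacian * (S * T) * M * T * (1 - E) := by rw [hNQ, hN]; simp only [mul_assoc]
      _ = S * (G.laplacian * M) * (T * (1 - E)) := by rw [hST, mul_one]; simp only [mul_assoc]
      _ = S * T * (1 - E) - S * (F * (T * (1 - E))) := by
          rw [hM.mul_eq, mul_sub, sub_mul, mul_one]; simp only [mul_assoc]; rfl
      _ = 1 - E := by rw [hFTQ, hST, mul_zero, sub_zero, one_mul]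
  · calc (1 - E) * (T * M * T) * (1 - E) * G.normalizedLaplacian
        = (1 - E) * (T * M * T) * ((1 - E) * G.normalizedLaplacian) := by simp only [mul_assoc]
      _ = (1 - E) * T * M * (T * S) * G.laplacian * S := by rw [hQN, hN]; simp only [mul_assoc]
      _ = (1 - E) * T * (M * G.laplacian) * S := by rw [hTS, mul_one]; simp only [mul_assoc]
      _ = (1 - E) * (T * S) - (1 - E) * T * F * S := by
          rw [hM.inv_mul_eq, mul_sub, sub_mul, mul_one]; simp only [mul_assoc]; rfl
      _ = 1 - E := by rw [hQTF, hTS, zero_mul, sub_zero, mul_one]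
  · have hQQ : (1 - E) * (1 - E) = 1 - E := by
      rw [mul_sub, mul_one, sub_mul, one_mul, hEE, sub_self, sub_zero]
    have hTv : T.mulVec v = √G.volume • G.stationary := by
      ext i
      simp only [hT, hv, Matrix.mulVec_diagonal, Pi.smul_apply, smul_eq_mul]
      rw [mul_right_comm, hsq, mul_comm]
    have hvT : Matrix.vecMul v T = √G.volume • G.stationary := by
      rw [← hTv, ← Matrix.mulVec_transpose, hT, Matrix.diagonal_transpose]
    rw [Matrix.trace_mul_comm, ← mul_assoc, hQQ, sub_mul, one_mul, Matrix.trace_sub]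
    have t1 : (T * M * T).trace = G.volume * ∑ i, G.stationary i * M i i := by
      rw [Matrix.trace, Finset.mul_sum]
      refine Finset.sum_congr rfl fun i _ => ?_
      rw [Matrix.diag_apply, hT, Matrix.mul_diagonal, Matrix.diagonal_mul]
      linear_combination (M i i * √G.volume * √G.volume) * hsq i +
        (M i i * G.stationary i) * hdsq
    have t2 : (E * (T * M * T)).trace =
        G.volume * (G.stationary ⬝ᵥ M.mulVec G.stationary) := by
      rw [hE, Matrix.vecMulVec_mul, Matrix.trace_vecMulVec, dotProduct_comm,
        ← Matrix.dotProduct_mulVec, ← Matrix.mulVec_mulVec, ← Matrix.mulVec_mulVec, hTv,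
        Matrix.dotProduct_mulVec, hvT, Matrix.mulVec_smul, smul_dotProduct, dotProduct_smul,
        smul_eq_mul, smul_eq_mul, ← mul_assoc, hdsq]
    rw [t1, t2, mul_sub]

end StronglyConnectedDigraph

theorem mainTheorem7 (n : ℕ) (G : StronglyConnectedDigraph n) :
    (G.kirchhoff = n * (pseudoinverse G.laplacian).trace ∧
      (G.kirchhoff : ℂ) = n * sumInvNonzeroEigenvalues G.laplacian) ∧
    ((∀ i : Fin n, G.kemeny i ≠ ⊤ ∧ G.mulKirchhoff = G.volume * (G.kemeny i).toReal) ∧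
      (G.mulKirchhoff : ℂ) = G.volume * sumInvNonzeroEigenvalues G.normalizedLaplacian ∧
      G.mulKirchhoff = G.volume * (pseudoinverse G.normalizedLaplacian).trace) := by
  rcases Nat.eq_zero_or_pos n with rfl | hn
  -- Without vertices there is no stationary distribution, but all sums are empty and the claims on
  -- starting vertices are vacuous.
  · simp [StronglyConnectedDigraph.kirchhoff, StronglyConnectedDigraph.mulKirchhoff,
      StronglyConnectedDigraph.volume]
  · have : Nonempty (Fin n) := ⟨⟨0, hn⟩⟩
    obtain ⟨M, hM⟩ := G.exists_invertsOffVector_laplacian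
    obtain ⟨N, hN, htr⟩ :=
      StronglyConnectedDigraph.exists_invertsOffVector_normalizedLaplacian hM
    have hR := StronglyConnectedDigraph.kirchhoff_eq hM
    have hR' : G.mulKirchhoff = G.volume * N.trace := by
      rw [StronglyConnectedDigraph.mulKirchhoff_eq hM, htr]; ring
    refine ⟨⟨?_, ?_⟩, fun i => ⟨StronglyConnectedDigraph.kemeny_ne_top i,
      StronglyConnectedDigraph.mulKirchhoff_eq_volume_mul_kemeny i⟩, ?_, ?_⟩
    · rw [hM.pseudoinverse_eq, hR]
    · rw [hM.sumInvNonzeroEigenvalues_eq, hR]; push_cast; rfl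
    · rw [hN.sumInvNonzeroEigenvalues_eq, hR']; push_cast; rfl
    · rw [hN.pseudoinverse_eq, hR']
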